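/- Let $X$ be a smooth manifold (Hausdorff, second countable, without boundary, not necessarily compact or connected) with a smooth Riemannian metric, let $p\ge 1$, and let $\phi$ be a calibration of degree $p$ on $X$, i.e. a smooth $d$-closed $p$-form with $\phi(\xi)\le 1$ for every unit simple $p$-vector $\xi$. Let $G(\phi)$ be the set of unit simple $p$-vectors $\xi$ (at points of $X$) with $\phi(\xi)=1$. A $p$-form $\beta$ is called $\Lambda^+(\phi)$-positive if $\beta(\xi)\ge 0$ for all $\xi\in G(\phi)$. Let $\mathcal D^k(X)$ be the space of smooth compactly supported $k$-forms and $\mathcal D'_k(X)$ its topological dual, the currents of dimension $k$, with boundary $(\partial T)(\alpha)=T(d\alpha)$; currents need not have compact support. A current $T\in\mathcal D'_p(X)$ is called $\Lambda_+(\phi)$-positive if $T(\beta)\ge 0$ for all $\Lambda^+(\phi)$-positive $\beta\in\mathcal D^p(X)$. Its mass is $$M(T)=\sup\{T(\beta):\ \beta\in\mathcal D^p(X),\ |\beta(\xi)|\le 1\ \text{for all unit simple } p\text{-vectors } \xi\}\in[0,\infty].$$ Theorem 4.4. For every $S\in\mathcal D'_{p-1}(X)$ and every real $\lambda>0$ the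 following are equivalent: (i) there exists a $\Lambda_+(\phi)$-positive current $T\in\mathcal D'_p(X)$ with $\partial T=S$ and $M(T)\le\lambda$; (ii) $S(\alpha)\ge-\lambda$ for all $\alpha\in\mathcal D^{p-1}(X)$ such that $d\alpha+\phi$ is $\Lambda^+(\phi)$-positive. -/

import Mathlib

open Set Filter Topology Manifold Bundle
open scoped ContDiff

noncomputable section

/-! ### Differential forms on a manifold without boundary, modelled on `ℝⁿ` -/

/-- A (not necessarily continuous) differential form of degree `k` on the `n`-manifold `X`. -/
abbrev FormField (n : ℕ) (X : Type*) [TopologicalSpace X]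
    [ChartedSpace (EuclideanSpace ℝ (Fin n)) X] (k : ℕ) : Type _ :=
  (x : X) → (TangentSpace (𝓡 n) x) [⋀^Fin k]→L[ℝ] ℝ

theorem norm_iteratedFDeriv_clm_comp_le {E F G : Type*} [NormedAddCommGroup E] [NormedSpace ℝ E]
    [NormedAddCommGroup F] [NormedSpace ℝ F] [NormedAddCommGroup G] [NormedSpace ℝ G]
    (A : F →L[ℝ] G) {C : ℝ} (hA : ‖A‖ ≤ C) {f : E → F} {y : E} (hf : ContDiffAt ℝ ∞ f y) (m : ℕ) :
    ‖iteratedFDeriv ℝ m (fun z ↦ A (f z)) y‖ ≤ C * ‖iteratedFDeriv ℝ m f y‖ := by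
  have hm : (m : WithTop ℕ∞) ≤ ∞ := by exact_mod_cast le_top
  have h := A.iteratedFDeriv_comp_left hf hm
  have h' : (fun z ↦ A (f z)) = A ∘ f := rfl
  rw [h', h]
  exact (ContinuousLinearMap.norm_compContinuousMultilinearMap_le _ _).trans (by gcongr)

theorem norm_iteratedFDeriv_extDeriv_le {E : Type*} [NormedAddCommGroup E] [NormedSpace ℝ E]
    {k : ℕ} {f : E → E [⋀^Fin k]→L[ℝ] ℝ} {U : Set E} (hU : IsOpen U) (hf : ContDiffOn ℝ ∞ f U)
    {y : E} (hy : y ∈ U) (m : ℕ) :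
    ‖iteratedFDeriv ℝ m (extDeriv f) y‖ ≤ (k + 1) * ‖iteratedFDeriv ℝ (m + 1) f y‖ := by
  have hsm : ContDiffAt ℝ ∞ (fderiv ℝ f) y :=
    (hf.fderiv_of_isOpen hU (by simp)).contDiffAt (hU.mem_nhds hy)
  have h := norm_iteratedFDeriv_clm_comp_le
    (ContinuousAlternatingMap.alternatizeUncurryFinCLM ℝ E ℝ (n := k))
    ContinuousAlternatingMap.norm_alternatizeUncurryFinCLM_le hsm m
  rw [norm_iteratedFDeriv_fderiv] at h
  exact h

section Forms

variable {n : ℕ} {X : Type*} [TopologicalSpace X] [ChartedSpace (EuclideanSpace ℝ (Fin n)) X]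
  {k : ℕ}

/-- The expression of a form in the chart at `a`: the pull-back of `η` by the inverse of the chart.
It is only meaningful on the target of the chart, which is open in `ℝⁿ`. -/
def coordRep (a : X) (η : FormField n X k) (y : EuclideanSpace ℝ (Fin n)) :
    (EuclideanSpace ℝ (Fin n)) [⋀^Fin k]→L[ℝ] ℝ :=
  (η ((extChartAt (𝓡 n) a).symm y)).compContinuousLinearMap
    (mfderiv (𝓘(ℝ, EuclideanSpace ℝ (Fin n))) (𝓡 n) (extChartAt (𝓡 n) a).symm y)

/-- A form is smooth if its expression in every chart is `C^∞`. -/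
def SmoothForm (η : FormField n X k) : Prop :=
  ∀ a : X, ContDiffOn ℝ ∞ (coordRep a η) (extChartAt (𝓡 n) a).target

/-- The exterior derivative: at `x`, it is the pull-back by the chart at `x` of the exterior
derivative of the expression of `η` in that chart. -/
def extD (η : FormField n X k) : FormField n X (k + 1) := fun x ↦
  (extDeriv (coordRep x η) (extChartAt (𝓡 n) x x)).compContinuousLinearMap
    (mfderiv (𝓡 n) (𝓘(ℝ, EuclideanSpace ℝ (Fin n))) (extChartAt (𝓡 n) x) x)

theorem coordRep_add (a : X) (η θ : FormField n X k) :
    coordRep a (η + θ) = coordRep a η + coordRep a θ := by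
  ext y v; rfl

theorem coordRep_smul (a : X) (c : ℝ) (η : FormField n X k) :
    coordRep a (c • η) = c • coordRep a η := by
  ext y v; rfl

theorem coordRep_zero (a : X) : coordRep a (0 : FormField n X k) = 0 := by
  ext y v; rfl

theorem SmoothForm.differentiableAt {η : FormField n X k} (hη : SmoothForm η) {a : X}
    {y : EuclideanSpace ℝ (Fin n)} (hy : y ∈ (extChartAt (𝓡 n) a).target) :
    DifferentiableAt ℝ (coordRep a η) y :=
  ((hη a).contDiffAt ((isOpen_extChartAt_target a).mem_nhds hy)).differentiableAt (by simp)

theorem coordRep_extChartAt (η : FormField n X k) {a x : X}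
    (hx : x ∈ (extChartAt (𝓡 n) a).source) :
    coordRep a η (extChartAt (𝓡 n) a x) = (η x).compContinuousLinearMap
      (mfderiv (𝓘(ℝ, EuclideanSpace ℝ (Fin n))) (𝓡 n) (extChartAt (𝓡 n) a).symm
        (extChartAt (𝓡 n) a x)) := by
  have key : ∀ x' : X, x' = x → ∀ v : Fin k → EuclideanSpace ℝ (Fin n),
      (show ((EuclideanSpace ℝ (Fin n)) [⋀^Fin k]→L[ℝ] ℝ) from η x') v =
      (show ((EuclideanSpace ℝ (Fin n)) [⋀^Fin k]→L[ℝ] ℝ) from η x) v := by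
    rintro x' rfl v; rfl
  ext v
  exact key _ ((extChartAt (𝓡 n) a).left_inv hx) _

section

variable [IsManifold (𝓡 n) ∞ X]

theorem mdifferentiableAt_extChartAt_symm' {a : X} {y : EuclideanSpace ℝ (Fin n)}
    (hy : y ∈ (extChartAt (𝓡 n) a).target) :
    MDifferentiableAt (𝓘(ℝ, EuclideanSpace ℝ (Fin n))) (𝓡 n) (extChartAt (𝓡 n) a).symm y := by
  have : IsManifold (𝓡 n) 1 X := IsManifold.of_le (n := ∞) (by simp)
  have := mdifferentiableWithinAt_extChartAt_symm (I := 𝓡 n) hy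
  simpa [mdifferentiableWithinAt_univ] using this

theorem mfderiv_extChartAt_symm_comp' {a x : X} (hx : x ∈ (extChartAt (𝓡 n) a).source) :
    (mfderiv (𝓘(ℝ, EuclideanSpace ℝ (Fin n))) (𝓡 n) (extChartAt (𝓡 n) a).symm
        (extChartAt (𝓡 n) a x)) ∘L
      (mfderiv (𝓡 n) (𝓘(ℝ, EuclideanSpace ℝ (Fin n))) (extChartAt (𝓡 n) a) x) =
      ContinuousLinearMap.id ℝ _ := by
  have : IsManifold (𝓡 n) 1 X := IsManifold.of_le (n := ∞) (by simp)
  have := mfderivWithin_extChartAt_symm_comp_mfderiv_extChartAt' (I := 𝓡 n) hx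
  simpa [mfderivWithin_univ] using this

/-- The expression of `extD η` in any chart is the exterior derivative of that of `η`. -/
theorem coordRep_extD {η : FormField n X k} (hη : SmoothForm η) {a : X}
    {y : EuclideanSpace ℝ (Fin n)} (hy : y ∈ (extChartAt (𝓡 n) a).target) :
    coordRep a (extD η) y = extDeriv (coordRep a η) y := by
  have : IsManifold (𝓡 n) 1 X := IsManifold.of_le (n := ∞) (by simp)
  set x : X := (extChartAt (𝓡 n) a).symm y with hx
  set τ : EuclideanSpace ℝ (Fin n) → EuclideanSpace ℝ (Fin n) :=
    extChartAt (𝓡 n) x ∘ (extChartAt (𝓡 n) a).symm with hτ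
  have hnear : ∀ᶠ z in 𝓝 y, z ∈ (extChartAt (𝓡 n) a).target ∧
      (extChartAt (𝓡 n) a).symm z ∈ (extChartAt (𝓡 n) x).source := by
    refine Filter.Eventually.and ((isOpen_extChartAt_target a).eventually_mem hy) ?_
    exact (mdifferentiableAt_extChartAt_symm' hy).continuousAt.eventually_mem
      (extChartAt_source_mem_nhds x)
  have hchain : ∀ z, z ∈ (extChartAt (𝓡 n) a).target →
      (extChartAt (𝓡 n) a).symm z ∈ (extChartAt (𝓡 n) x).source →
      fderiv ℝ τ z = (mfderiv (𝓡 n) (𝓘(ℝ, EuclideanSpace ℝ (Fin n))) (extChartAt (𝓡 n) x)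
        ((extChartAt (𝓡 n) a).symm z)) ∘L
        (mfderiv (𝓘(ℝ, EuclideanSpace ℝ (Fin n))) (𝓡 n) (extChartAt (𝓡 n) a).symm z) := by
    intro z hz hz'
    rw [← mfderiv_eq_fderiv, hτ]
    exact mfderiv_comp z (mdifferentiableAt_extChartAt (by simpa using hz'))
      (mdifferentiableAt_extChartAt_symm' hz)
  have hpull : coordRep a η =ᶠ[𝓝 y]
      fun z ↦ (coordRep x η (τ z)).compContinuousLinearMap (fderiv ℝ τ z) := by
    filter_upwards [hnear] with z hz
    have h1 := mfderiv_extChartAt_symm_comp' hz.2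
    rw [hchain z hz.1 hz.2]
    have h2 : coordRep x η (τ z) = _ := coordRep_extChartAt η hz.2
    rw [h2]
    ext v
    have h3 : ∀ w : EuclideanSpace ℝ (Fin n), (mfderiv (𝓘(ℝ, EuclideanSpace ℝ (Fin n))) (𝓡 n)
        (extChartAt (𝓡 n) x).symm (extChartAt (𝓡 n) x ((extChartAt (𝓡 n) a).symm z)))
        ((mfderiv (𝓡 n) (𝓘(ℝ, EuclideanSpace ℝ (Fin n))) (extChartAt (𝓡 n) x)
        ((extChartAt (𝓡 n) a).symm z)) w) = w := fun w ↦ DFunLike.congr_fun h1 w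
    refine congrArg (η ((extChartAt (𝓡 n) a).symm z)) ?_
    funext i
    exact (h3 _).symm
  have hy' : x ∈ (extChartAt (𝓡 n) x).source := mem_extChartAt_source x
  have hτs : ContDiffAt ℝ ∞ τ y := by
    have h1 : ContMDiffAt (𝓡 n) (𝓘(ℝ, EuclideanSpace ℝ (Fin n))) ∞ (extChartAt (𝓡 n) x) x :=
      contMDiffAt_extChartAt
    have h2 : ContMDiffAt (𝓘(ℝ, EuclideanSpace ℝ (Fin n))) (𝓡 n) ∞ (extChartAt (𝓡 n) a).symm y :=
      (contMDiffOn_extChartAt_symm a).contMDiffAt ((isOpen_extChartAt_target a).mem_nhds hy)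
    exact (ContMDiffAt.comp y h1 h2).contDiffAt
  rw [hpull.extDeriv_eq, extDeriv_pullback (f := τ) (r := ∞)
    (hη.differentiableAt ((extChartAt (𝓡 n) x).map_source hy')) hτs (by simpa using (WithTop.coe_le_coe.2 le_top : ((2 : ℕ∞) : WithTop ℕ∞) ≤ ∞)),
    hchain y hy hy']
  rfl

theorem SmoothForm.extD {η : FormField n X k} (hη : SmoothForm η) : SmoothForm (extD η) := by
  intro a
  have ho := isOpen_extChartAt_target (I := 𝓡 n) a
  refine ContDiffOn.congr (f := fun y ↦ ContinuousAlternatingMap.alternatizeUncurryFinCLM ℝ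
    (EuclideanSpace ℝ (Fin n)) ℝ (fderiv ℝ (coordRep a η) y)) ?_ fun y hy ↦ coordRep_extD hη hy
  exact (ContinuousLinearMap.contDiff _).comp_contDiffOn
    ((hη a).fderiv_of_isOpen ho (by simp))

end

theorem extD_add {η θ : FormField n X k} (hη : SmoothForm η) (hθ : SmoothForm θ) :
    extD (η + θ) = extD η + extD θ := by
  funext x
  have hx := mem_extChartAt_target (I := 𝓡 n) x
  simp only [extD, Pi.add_apply, coordRep_add]
  rw [extDeriv_add (hη.differentiableAt hx) (hθ.differentiableAt hx)]
  rfl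

theorem extD_smul (c : ℝ) (η : FormField n X k) : extD (c • η) = c • extD η := by
  funext x
  simp only [extD, Pi.smul_apply, coordRep_smul]
  rw [extDeriv_smul]
  rfl

theorem extD_eq_zero_of_eventually {η : FormField n X k} {x : X} (h : ∀ᶠ y in 𝓝 x, η y = 0) :
    extD η x = 0 := by
  have h1 : coordRep x η =ᶠ[𝓝 (extChartAt (𝓡 n) x x)] coordRep x 0 := by
    have hc : ContinuousAt (extChartAt (𝓡 n) x).symm (extChartAt (𝓡 n) x x) :=
      continuousAt_extChartAt_symm x
    have h' : ∀ᶠ y in 𝓝 ((extChartAt (𝓡 n) x).symm (extChartAt (𝓡 n) x x)), η y = 0 := by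
      rwa [extChartAt_to_inv x]
    filter_upwards [hc.eventually h'] with y hy
    simp only [coordRep, hy, Pi.zero_apply]
  rw [extD, h1.extDeriv_eq, coordRep_zero]
  have h2 : extDeriv (0 : EuclideanSpace ℝ (Fin n) → (EuclideanSpace ℝ (Fin n)) [⋀^Fin k]→L[ℝ] ℝ)
      (extChartAt (𝓡 n) x x) = 0 := by
    simp [extDeriv, ← ContinuousAlternatingMap.alternatizeUncurryFinCLM_apply]
  rw [h2]
  rfl

theorem extD_support_subset (η : FormField n X k) :
    {x | extD η x ≠ 0} ⊆ closure {x | η x ≠ 0} := by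
  intro x hx
  by_contra hxs
  refine hx (extD_eq_zero_of_eventually ?_)
  filter_upwards [isClosed_closure.isOpen_compl.mem_nhds hxs] with y hy
  by_contra h
  exact hy (subset_closure h)

end Forms

/-! ### Test forms and currents -/

/-- `𝓓ᵏ(X)`: the smooth forms of degree `k` on `X` with compact support. -/
def TestForm (n : ℕ) (X : Type*) [TopologicalSpace X]
    [ChartedSpace (EuclideanSpace ℝ (Fin n)) X] (k : ℕ) : Submodule ℝ (FormField n X k) where
  carrier := {η | SmoothForm η ∧ IsCompact (closure {x | η x ≠ 0})}
  zero_mem' := by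
    refine ⟨fun a ↦ ?_, by simp⟩
    rw [coordRep_zero]
    exact contDiffOn_const
  add_mem' := by
    rintro η θ ⟨hη, hη'⟩ ⟨hθ, hθ'⟩
    refine ⟨fun a ↦ ?_, ?_⟩
    · rw [coordRep_add]
      exact (hη a).add (hθ a)
    · refine (hη'.union hθ').of_isClosed_subset isClosed_closure ?_
      rw [← closure_union]
      refine closure_mono fun x hx ↦ ?_
      by_contra h
      simp only [mem_union, mem_ofPred_eq, not_or, not_not] at h
      exact hx (by simp [h.1, h.2])
  smul_mem' := by
    rintro c η ⟨hη, hη'⟩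
    refine ⟨fun a ↦ ?_, ?_⟩
    · rw [coordRep_smul]
      exact contDiffOn_const.smul (hη a)
    · refine hη'.of_isClosed_subset isClosed_closure (closure_mono fun x hx h ↦ hx ?_)
      simp [h]

section Currents

variable {n : ℕ} {X : Type*} [TopologicalSpace X] [ChartedSpace (EuclideanSpace ℝ (Fin n)) X]
  {k : ℕ}

/-- The exterior derivative `d : 𝓓ᵏ(X) → 𝓓ᵏ⁺¹(X)`. -/
def TestForm.d [IsManifold (𝓡 n) ∞ X] : TestForm n X k →ₗ[ℝ] TestForm n X (k + 1) where
  toFun α := ⟨extD α.1, α.2.1.extD,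
    α.2.2.of_isClosed_subset isClosed_closure
      (closure_minimal (extD_support_subset α.1) isClosed_closure)⟩
  map_add' α β := Subtype.ext (extD_add α.2.1 β.2.1)
  map_smul' c α := Subtype.ext (extD_smul c α.1)

/-- Convergence `αⱼ → 0` in `𝓓ᵏ(X)`: all supports lie in one compact set, and in every chart the
coefficients converge to zero with all their derivatives, uniformly on compact sets. -/
def TestForm.TendstoZero (α : ℕ → TestForm n X k) : Prop :=
  (∃ K : Set X, IsCompact K ∧ ∀ j, closure {x | (α j).1 x ≠ 0} ⊆ K) ∧
  ∀ (a : X) (m : ℕ) (L : Set (EuclideanSpace ℝ (Fin n))), IsCompact L →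
    L ⊆ (extChartAt (𝓡 n) a).target →
    TendstoUniformlyOn (fun j y ↦ iteratedFDeriv ℝ m (coordRep a (α j).1) y) 0 atTop L

end Currents

/-- `𝓓'ₖ(X)`: the currents of dimension `k` on `X`, that is, the continuous linear functionals
on `𝓓ᵏ(X)`. Since `𝓓ᵏ(X)` is a strict inductive limit of Fréchet spaces, continuity of a linear
functional is sequential continuity at zero. -/
@[ext]
structure Current (n : ℕ) (X : Type*) [TopologicalSpace X]
    [ChartedSpace (EuclideanSpace ℝ (Fin n)) X] (k : ℕ) where
  toFun : TestForm n X k →ₗ[ℝ] ℝ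
  continuous' : ∀ α : ℕ → TestForm n X k, TestForm.TendstoZero α →
    Tendsto (fun j ↦ toFun (α j)) atTop (𝓝 0)

section Positivity

variable {n : ℕ} {X : Type*} [TopologicalSpace X] [ChartedSpace (EuclideanSpace ℝ (Fin n)) X]
  {k : ℕ}

instance : CoeFun (Current n X k) (fun _ ↦ TestForm n X k → ℝ) := ⟨fun T ↦ T.toFun⟩

variable [IsManifold (𝓡 n) ∞ X]

theorem TestForm.TendstoZero.d {α : ℕ → TestForm n X k} (hα : TestForm.TendstoZero α) :
    TestForm.TendstoZero fun j ↦ TestForm.d (α j) := by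
  obtain ⟨⟨K, hK, hK'⟩, hconv⟩ := hα
  refine ⟨⟨K, hK, fun j ↦ ?_⟩, fun a m L hL hLt ↦ ?_⟩
  · exact (closure_minimal (extD_support_subset (α j).1) isClosed_closure).trans (hK' j)
  · have h := hconv a (m + 1) L hL hLt
    rw [Metric.tendstoUniformlyOn_iff] at h ⊢
    intro ε hε
    have hk : (0 : ℝ) < k + 1 := by positivity
    filter_upwards [h (ε / (k + 1)) (by positivity)] with j hj y hy
    have hj' := hj y hy
    simp only [Pi.zero_apply, dist_zero_left] at hj' ⊢
    have hyt := hLt hy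
    have ho := isOpen_extChartAt_target (I := 𝓡 n) a
    have heq : coordRep a (TestForm.d (α j)).1 =ᶠ[𝓝 y] extDeriv (coordRep a (α j).1) := by
      filter_upwards [ho.mem_nhds hyt] with z hz
      exact coordRep_extD (α j).2.1 hz
    rw [(heq.iteratedFDeriv ℝ m).eq_of_nhds]
    refine (norm_iteratedFDeriv_extDeriv_le ho ((α j).2.1 a) hyt m).trans_lt ?_
    rw [lt_div_iff₀ hk] at hj'
    linarith
  
/-- The boundary `∂T` of a current: `(∂T)(α) = T(dα)`. -/
def Current.boundary (T : Current n X (k + 1)) : Current n X k where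
  toFun := T.toFun ∘ₗ TestForm.d
  continuous' _ hα := T.continuous' _ hα.d

/-- A smooth Riemannian metric on the manifold `X`. -/
abbrev RMetric (n : ℕ) (X : Type*) [TopologicalSpace X]
    [ChartedSpace (EuclideanSpace ℝ (Fin n)) X] [IsManifold (𝓡 n) ∞ X] : Type _ :=
  ContMDiffRiemannianMetric (𝓡 n) ∞ (EuclideanSpace ℝ (Fin n))
    (fun x : X ↦ TangentSpace (𝓡 n) x)

/-- Orthonormal `k`-frames `v` at `x`. They represent the unit simple `k`-vectors
`ξ = v₁ ∧ ⋯ ∧ vₖ` at `x` (each of these is represented by some frame), with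
`η(ξ) = η(v₁, …, vₖ)` for a form `η`. -/
def IsOrthonormalFrame (g : RMetric n X) (x : X) (v : Fin k → TangentSpace (𝓡 n) x) : Prop :=
  ∀ i j, g.inner x (v i) (v j) = if i = j then 1 else 0

/-- The comass of `η` at `x`: the supremum of `|η(ξ)|` over the unit simple `k`-vectors `ξ`. -/
def comassAt (g : RMetric n X) (η : FormField n X k) (x : X) : ENNReal :=
  ⨆ (v : Fin k → TangentSpace (𝓡 n) x) (_ : IsOrthonormalFrame g x v), ‖η x v‖ₑ

/-- `φ` is a calibration: a smooth closed form with `φ(ξ) ≤ 1` for every unit simple `ξ`. -/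
structure IsCalibration (g : RMetric n X) (φ : FormField n X k) : Prop where
  smooth : SmoothForm φ
  closed : extD φ = 0
  le_one : ∀ (x : X) (v : Fin k → TangentSpace (𝓡 n) x), IsOrthonormalFrame g x v → φ x v ≤ 1

/-- The `φ`-Grassmannian `G(φ)` at `x`: the unit simple vectors `ξ` at `x` with `φ(ξ) = 1`,
represented by orthonormal frames. -/
def phiGrassmannian (g : RMetric n X) (φ : FormField n X k) (x : X) :
    Set (Fin k → TangentSpace (𝓡 n) x) :=
  {v | IsOrthonormalFrame g x v ∧ φ x v = 1}

/-- `η` is `Λ⁺(φ)`-positive: at each point, `η(ξ) ≥ 0` for all `ξ ∈ G(φ)`. -/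
def FormPositive (g : RMetric n X) (φ η : FormField n X k) : Prop :=
  ∀ x, ∀ v ∈ phiGrassmannian g φ x, 0 ≤ η x v

/-- `T` is `Λ₊(φ)`-positive: `T(β) ≥ 0` for all `Λ⁺(φ)`-positive test forms `β`. -/
def Current.Positive (g : RMetric n X) (φ : FormField n X k) (T : Current n X k) : Prop :=
  ∀ β : TestForm n X k, FormPositive g φ β.1 → 0 ≤ T β

/-- The mass of a current: the supremum of `T(β)` over the test forms `β` of comass at most one. -/
def Current.mass (g : RMetric n X) (T : Current n X k) : ENNReal :=
  ⨆ (β : TestForm n X k) (_ : ∀ x, comassAt g β.1 x ≤ 1), ENNReal.ofReal (T β)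

end Positivity

end

/-! The condition "positive of mass at most `lam`" is a one-sided bound: T ≤ `lam` · `phiSup`, where
`phiSup` β is the larger of 0 and the supremum of β over G(φ). Any linear functional with this bound
is nonnegative on positive forms (test it on -β), has mass at most `lam`, and is automatically
continuous, because convergence of test forms is uniform on orthonormal frames
(`TestForm.TendstoZero.eventually_frame_le`). For existence, rescaling α in the hypothesis gives S ≤
`lam` · `phiSup` ∘ d (`Current.apply_le_mul_phiSup`). Then S factors through the exact forms d𝓓, and
Hahn–Banach (`exists_comp_eq_of_le_sublinear`) extends it to the required T. Conversely, one would
like to write T(dα) = T(dα + φ) - T(φ) ≥ -`lam`, but φ need not have compact support. It is replaced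
by fφ, with f a cutoff equal to 1 on the support of dα (`Current.neg_le_boundary_apply`). -/

noncomputable section

/-! ### Uniform bounds for forms on orthonormal frames -/

section FrameBounds

variable {n : ℕ} {X : Type*} [TopologicalSpace X] [ChartedSpace (EuclideanSpace ℝ (Fin n)) X]
  [IsManifold (𝓡 n) ∞ X] {k : ℕ}

/-- Near `a` the chart derivative is the tangent bundle trivialization, whose operator norm with
respect to `g` is locally bounded because `g` is continuous. -/
theorem eventually_norm_mfderiv_extChartAt_le (g : RMetric n X) (a : X) :
    ∃ C : ℝ, 0 ≤ C ∧ ∀ᶠ x in 𝓝 a, ∀ v : TangentSpace (𝓡 n) x, g.inner x v v = 1 →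
      ‖(show EuclideanSpace ℝ (Fin n) from
        mfderiv (𝓡 n) (𝓘(ℝ, EuclideanSpace ℝ (Fin n))) (extChartAt (𝓡 n) a) x v)‖ ≤ C := by
  have : IsManifold (𝓡 n) 1 X := IsManifold.of_le (n := ∞) (by simp)
  let : RiemannianBundle (fun x : X ↦ TangentSpace (𝓡 n) x) := ⟨g.toRiemannianMetric⟩
  have : IsContinuousRiemannianBundle (EuclideanSpace ℝ (Fin n))
      (fun x : X ↦ TangentSpace (𝓡 n) x) :=
    ⟨g.inner, g.contMDiff.continuous, fun _ _ _ ↦ rfl⟩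
  obtain ⟨C, hC, h⟩ := eventually_norm_trivializationAt_lt (EuclideanSpace ℝ (Fin n))
    (fun x : X ↦ TangentSpace (𝓡 n) x) a
  refine ⟨C, hC.le, ?_⟩
  filter_upwards [h, chart_source_mem_nhds (EuclideanSpace ℝ (Fin n)) a] with x hx hxs v hv
  rw [TangentBundle.continuousLinearMapAt_trivializationAt hxs] at hx
  have hv1 : ‖v‖ = 1 := by
    have h2 : g.inner x v v = ‖v‖ ^ 2 := real_inner_self_eq_norm_sq v
    rw [hv] at h2
    nlinarith [norm_nonneg v]
  have h3 := ContinuousLinearMap.le_of_opNorm_le _ hx.le v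
  rwa [hv1, mul_one] at h3

theorem apply_eq_coordRep (η : FormField n X k) {a x : X}
    (hx : x ∈ (extChartAt (𝓡 n) a).source) (v : Fin k → TangentSpace (𝓡 n) x) :
    η x v = coordRep a η (extChartAt (𝓡 n) a x)
      (fun i ↦ mfderiv (𝓡 n) (𝓘(ℝ, EuclideanSpace ℝ (Fin n))) (extChartAt (𝓡 n) a) x (v i)) := by
  rw [coordRep_extChartAt η hx]
  refine congrArg (η x) (funext fun i ↦ ?_)
  exact (DFunLike.congr_fun (mfderiv_extChartAt_symm_comp' hx) (v i)).symm

/-- On a compact set, the values of forms on orthonormal frames are controlled by finitely many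
coordinate expressions over compact sets. -/
theorem IsCompact.exists_frame_bound (g : RMetric n X) (k : ℕ) {K : Set X} (hK : IsCompact K) :
    ∃ (t : Finset X) (L : X → Set (EuclideanSpace ℝ (Fin n))) (C : X → ℝ),
      (∀ a, IsCompact (L a) ∧ L a ⊆ (extChartAt (𝓡 n) a).target ∧ 0 ≤ C a) ∧
      ∀ x ∈ K, ∃ a ∈ t, ∃ y ∈ L a, ∀ (η : FormField n X k) (v : Fin k → TangentSpace (𝓡 n) x),
        IsOrthonormalFrame g x v → |η x v| ≤ C a * ‖coordRep a η y‖ := by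
  have hloc : ∀ a : X, ∃ (L : Set (EuclideanSpace ℝ (Fin n))) (C : ℝ) (U : Set X),
      (IsCompact L ∧ L ⊆ (extChartAt (𝓡 n) a).target ∧ 0 ≤ C) ∧ U ∈ 𝓝 a ∧
      ∀ x ∈ U, ∃ y ∈ L, ∀ (η : FormField n X k) (v : Fin k → TangentSpace (𝓡 n) x),
        IsOrthonormalFrame g x v → |η x v| ≤ C * ‖coordRep a η y‖ := by
    intro a
    obtain ⟨C, hC, h⟩ := eventually_norm_mfderiv_extChartAt_le g a
    obtain ⟨r, hr, hrt⟩ := Metric.nhds_basis_closedBall.mem_iff.1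
      (extChartAt_target_mem_nhds (I := 𝓡 n) a)
    -- One factor `C` for each of the `k` frame vectors read in the chart.
    refine ⟨Metric.closedBall (extChartAt (𝓡 n) a a) r, C ^ k, _,
      ⟨isCompact_closedBall _ _, hrt, by positivity⟩,
      Filter.Eventually.and h (inter_mem (extChartAt_source_mem_nhds (I := 𝓡 n) a)
        ((continuousAt_extChartAt (I := 𝓡 n) a).eventually_mem
          (Metric.closedBall_mem_nhds _ hr))), ?_⟩
    rintro x ⟨hx, hxs, hxr⟩
    refine ⟨_, hxr, fun η v hv ↦ ?_⟩
    rw [apply_eq_coordRep η hxs v, ← Real.norm_eq_abs, mul_comm]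
    refine (ContinuousAlternatingMap.le_opNorm _ _).trans ?_
    gcongr
    refine (Finset.prod_le_prod (fun _ _ ↦ norm_nonneg _)
      (fun i _ ↦ hx (v i) (by simpa using hv i i))).trans ?_
    simp
  choose L C U hL hU hb using hloc
  obtain ⟨t, -, ht⟩ := hK.elim_nhds_subcover U fun a _ ↦ hU a
  refine ⟨t, L, C, hL, fun x hx ↦ ?_⟩
  obtain ⟨a, ha, hxa⟩ := mem_iUnion₂.1 (ht hx)
  exact ⟨a, ha, hb a x hxa⟩

/-- Compactness of the support gives the bound; it makes the supremum in `phiSup` finite. -/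
theorem TestForm.exists_frame_bound (g : RMetric n X) (β : TestForm n X k) :
    ∃ B : ℝ, ∀ (x : X) (v : Fin k → TangentSpace (𝓡 n) x),
      IsOrthonormalFrame g x v → |β.1 x v| ≤ B := by
  obtain ⟨t, L, C, hL, hb⟩ := β.2.2.exists_frame_bound g k
  have hbd : ∀ a, ∃ D, ∀ y ∈ L a, ‖coordRep a β.1 y‖ ≤ D := fun a ↦
    (hL a).1.exists_bound_of_continuousOn ((β.2.1 a).continuousOn.mono (hL a).2.1)
  choose D hD using hbd
  -- The sum dominates each term; `|D a|` is used because `D a` may be negative if `L a` is empty.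
  refine ⟨∑ a ∈ t, C a * |D a|, fun x v hv ↦ ?_⟩
  have hsum : ∀ a ∈ t, 0 ≤ C a * |D a| := fun a _ ↦ mul_nonneg (hL a).2.2 (abs_nonneg _)
  by_cases hx : β.1 x = 0
  · rw [hx]
    simpa using Finset.sum_nonneg hsum
  · obtain ⟨a, ha, y, hy, h⟩ := hb x (subset_closure hx)
    refine (h β.1 v hv).trans (le_trans ?_ (Finset.single_le_sum hsum ha))
    exact mul_le_mul_of_nonneg_left ((hD a y hy).trans (le_abs_self _)) (hL a).2.2

theorem TestForm.TendstoZero.eventually_frame_le (g : RMetric n X) {α : ℕ → TestForm n X k}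
    (hα : TestForm.TendstoZero α) {ε : ℝ} (hε : 0 < ε) :
    ∀ᶠ j in atTop, ∀ (x : X) (v : Fin k → TangentSpace (𝓡 n) x),
      IsOrthonormalFrame g x v → |(α j).1 x v| ≤ ε := by
  obtain ⟨⟨K, hK, hKs⟩, hconv⟩ := hα
  obtain ⟨t, L, C, hL, hb⟩ := hK.exists_frame_bound g k
  have hev : ∀ a ∈ t, ∀ᶠ j in atTop, ∀ y ∈ L a, C a * ‖coordRep a (α j).1 y‖ ≤ ε := by
    intro a _
    have hC : 0 < C a + 1 := by linarith [(hL a).2.2]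
    -- Only derivatives of order zero are needed.
    have h := hconv a 0 (L a) (hL a).1 (hL a).2.1
    rw [Metric.tendstoUniformlyOn_iff] at h
    filter_upwards [h (ε / (C a + 1)) (by positivity)] with j hj y hy
    have h1 := hj y hy
    simp only [Pi.zero_apply, dist_zero_left, norm_iteratedFDeriv_zero] at h1
    rw [lt_div_iff₀ hC] at h1
    nlinarith [norm_nonneg (coordRep a (α j).1 y)]
  filter_upwards [(Filter.eventually_all_finset t).2 hev] with j hj x v hv
  by_cases hx : (α j).1 x = 0
  · rw [hx]
    simpa using hε.le
  · obtain ⟨a, ha, y, hy, h⟩ := hb x (hKs j (subset_closure hx))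
    exact (h _ v hv).trans (hj a ha y hy)

end FrameBounds

/-! ### Truncating a smooth form to a test form -/

section Cutoff

variable {n : ℕ} {X : Type*} [TopologicalSpace X] [ChartedSpace (EuclideanSpace ℝ (Fin n)) X]
  [IsManifold (𝓡 n) ∞ X] {k : ℕ}

theorem SmoothForm.smul_contMDiff {η : FormField n X k} (hη : SmoothForm η) {f : X → ℝ}
    (hf : ContMDiff (𝓡 n) 𝓘(ℝ, ℝ) ∞ f) : SmoothForm (fun x ↦ f x • η x) := by
  intro a
  have h : ContDiffOn ℝ ∞ (f ∘ (extChartAt (𝓡 n) a).symm) (extChartAt (𝓡 n) a).target :=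
    (hf.comp_contMDiffOn (contMDiffOn_extChartAt_symm a)).contDiffOn
  exact h.smul (hη a)

theorem SmoothForm.exists_testForm_cutoff [T2Space X] [SecondCountableTopology X]
    {η : FormField n X k} (hη : SmoothForm η) {K : Set X} (hK : IsCompact K) :
    ∃ (β : TestForm n X k) (f : X → ℝ), (∀ x, β.1 x = f x • η x) ∧ (∀ x, f x ∈ Icc (0 : ℝ) 1) ∧
      ∀ x ∈ K, f x = 1 := by
  have : LocallyCompactSpace X := ChartedSpace.locallyCompactSpace (EuclideanSpace ℝ (Fin n)) X
  have : SigmaCompactSpace X := inferInstance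
  obtain ⟨K', hK', hKK'⟩ := exists_compact_superset hK
  obtain ⟨f, hf1, hf0, hf⟩ := exists_contMDiffMap_one_nhds_of_subset_interior (n := ⊤) (𝓡 n)
    hK.isClosed hKK'
  refine ⟨⟨fun x ↦ f x • η x, hη.smul_contMDiff f.contMDiff, ?_⟩, f, fun _ ↦ rfl, hf,
    fun x hx ↦ hf1.self_of_nhdsSet x hx⟩
  refine hK'.of_isClosed_subset isClosed_closure (closure_minimal (fun x hx ↦ ?_) hK'.isClosed)
  by_contra h
  exact hx (by simp [hf0 x h])

end Cutoff

/-- Hahn–Banach theorem for a functional given on the range of a linear map. -/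
theorem exists_comp_eq_of_le_sublinear {E F : Type*} [AddCommGroup E] [Module ℝ E]
    [AddCommGroup F] [Module ℝ F] (d : E →ₗ[ℝ] F) (S : E →ₗ[ℝ] ℝ) (N : F → ℝ)
    (N_hom : ∀ c : ℝ, 0 < c → ∀ x, N (c • x) = c * N x) (N_add : ∀ x y, N (x + y) ≤ N x + N y)
    (hS : ∀ x, S x ≤ N (d x)) :
    ∃ T : F →ₗ[ℝ] ℝ, (∀ x, T (d x) = S x) ∧ ∀ y, T y ≤ N y := by
  have hN : N 0 = 0 := by
    have h := N_hom 2 two_pos 0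
    rw [smul_zero] at h
    linarith
  -- Applying the bound to both `x` and `-x` forces `S` to vanish on the kernel, so it descends to
  -- the range.
  have hker : LinearMap.ker d ≤ LinearMap.ker S := by
    have h0 : ∀ x, d x = 0 → S x ≤ 0 := fun x hx ↦ by simpa [hx, hN] using hS x
    intro x hx
    rw [LinearMap.mem_ker] at hx ⊢
    have h := h0 (-x) (by rw [map_neg, hx, neg_zero])
    rw [map_neg] at h
    linarith [h0 x hx]
  let S' : LinearMap.range d →ₗ[ℝ] ℝ :=
    (Submodule.liftQ _ S hker) ∘ₗ d.quotKerEquivRange.symm.toLinearMap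
  have hS' : ∀ x, S' ⟨d x, LinearMap.mem_range_self _ x⟩ = S x := fun x ↦ by
    have h : d.quotKerEquivRange.symm ⟨d x, LinearMap.mem_range_self _ x⟩ =
        Submodule.Quotient.mk x := by
      rw [LinearEquiv.symm_apply_eq]
      rfl
    change Submodule.liftQ _ S hker (d.quotKerEquivRange.symm _) = _
    rw [h]
    rfl
  obtain ⟨T, hT, hT'⟩ := exists_extension_of_le_sublinear ⟨_, S'⟩ N N_hom N_add (by
    rintro ⟨_, x, rfl⟩
    exact (hS' x).trans_le (hS x))
  exact ⟨T, fun x ↦ (hT ⟨d x, LinearMap.mem_range_self _ x⟩).trans (hS' x), hT'⟩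

/-! ### Comass of a calibration and the sublinear functional -/

section Calibration

variable {n : ℕ} {X : Type*} [TopologicalSpace X] [ChartedSpace (EuclideanSpace ℝ (Fin n)) X]
  [IsManifold (𝓡 n) ∞ X] {k : ℕ} {g : RMetric n X}

theorem IsOrthonormalFrame.update_neg {x : X} {v : Fin k → TangentSpace (𝓡 n) x}
    (hv : IsOrthonormalFrame g x v) (l : Fin k) :
    IsOrthonormalFrame g x (Function.update v l (-v l)) := by
  intro i j
  rcases eq_or_ne i l with rfl | hi <;> rcases eq_or_ne j i with rfl | hj
  · simpa using hv j j
  · simpa [Function.update_of_ne hj, hj.symm] using hv i j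
  · simpa [Function.update_of_ne hi] using hv j j
  · rcases eq_or_ne j l with rfl | hj'
    · simpa [Function.update_of_ne hi, hi] using hv i j
    · simpa [Function.update_of_ne hi, Function.update_of_ne hj'] using hv i j

/-- Negating one frame vector reverses the sign of `φ`. This needs positive degree, whence `k + 1`.
-/
theorem IsCalibration.abs_le_one {φ : FormField n X (k + 1)} (hφ : IsCalibration g φ) {x : X}
    {v : Fin (k + 1) → TangentSpace (𝓡 n) x} (hv : IsOrthonormalFrame g x v) : |φ x v| ≤ 1 := by
  refine abs_le.2 ⟨?_, hφ.le_one x v hv⟩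
  have h := hφ.le_one x _ (hv.update_neg 0)
  have h1 : φ x (Function.update v 0 (-v 0)) = -φ x v := by
    have h2 := (φ x).toMultilinearMap.map_update_neg v 0 (v 0)
    rw [Function.update_eq_self] at h2
    exact h2
  linarith

theorem comassAt_le_one_iff {η : FormField n X k} {x : X} :
    comassAt g η x ≤ 1 ↔ ∀ v : Fin k → TangentSpace (𝓡 n) x, IsOrthonormalFrame g x v →
      |η x v| ≤ 1 := by
  simp only [comassAt, iSup_le_iff]
  refine forall₂_congr fun v _ ↦ ?_
  rw [← enorm_one (G := ℝ), enorm_le_iff_norm_le, norm_one, Real.norm_eq_abs]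

/-- `λ · max(0, sup_{G(φ)} η)`: for `λ ≥ 0` the sublinear functional that majorizes exactly the
`Λ₊(φ)`-positive functionals of mass at most `λ`. -/
def phiSup (g : RMetric n X) (φ η : FormField n X k) : ℝ :=
  sSup (insert 0 {r | ∃ x, ∃ v ∈ phiGrassmannian g φ x, η x v = r})

variable {φ : FormField n X k}

theorem bddAbove_phiSup (φ : FormField n X k) (β : TestForm n X k) :
    BddAbove (insert 0 {r | ∃ x, ∃ v ∈ phiGrassmannian g φ x, β.1 x v = r}) := by
  obtain ⟨B, hB⟩ := TestForm.exists_frame_bound g β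
  refine BddAbove.insert 0 ⟨B, ?_⟩
  rintro _ ⟨x, v, hv, rfl⟩
  exact (le_abs_self _).trans (hB x v hv.1)

theorem phiSup_nonneg (β : TestForm n X k) : 0 ≤ phiSup g φ β.1 :=
  le_csSup (bddAbove_phiSup φ β) (mem_insert _ _)

theorem le_phiSup (β : TestForm n X k) {x : X} {v : Fin k → TangentSpace (𝓡 n) x}
    (hv : v ∈ phiGrassmannian g φ x) : β.1 x v ≤ phiSup g φ β.1 :=
  le_csSup (bddAbove_phiSup φ β) (mem_insert_of_mem _ ⟨x, v, hv, rfl⟩)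

theorem phiSup_le {η : FormField n X k} {c : ℝ} (hc : 0 ≤ c)
    (h : ∀ x, ∀ v ∈ phiGrassmannian g φ x, η x v ≤ c) : phiSup g φ η ≤ c := by
  refine csSup_le (insert_nonempty _ _) ?_
  rintro _ (rfl | ⟨x, v, hv, rfl⟩)
  exacts [hc, h x v hv]

theorem phiSup_add_le (β γ : TestForm n X k) :
    phiSup g φ (β + γ).1 ≤ phiSup g φ β.1 + phiSup g φ γ.1 :=
  phiSup_le (add_nonneg (phiSup_nonneg β) (phiSup_nonneg γ)) fun _ _ hv ↦
    add_le_add (le_phiSup β hv) (le_phiSup γ hv)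

theorem phiSup_smul {c : ℝ} (hc : 0 < c) (β : TestForm n X k) :
    phiSup g φ (c • β).1 = c * phiSup g φ β.1 := by
  have key : ∀ {c : ℝ}, 0 < c → ∀ β : TestForm n X k,
      phiSup g φ (c • β).1 ≤ c * phiSup g φ β.1 := fun hc β ↦
    phiSup_le (mul_nonneg hc.le (phiSup_nonneg β)) fun _ _ hv ↦
      mul_le_mul_of_nonneg_left (le_phiSup β hv) hc.le
  refine (key hc β).antisymm ?_
  have h := key (inv_pos.2 hc) (c • β)
  rwa [inv_smul_smul₀ hc.ne', le_inv_mul_iff₀ hc] at h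

theorem abs_le_mul_of_le_mul_phiSup {T : TestForm n X k →ₗ[ℝ] ℝ} {lam : ℝ} (hlam : 0 ≤ lam)
    (hT : ∀ β, T β ≤ lam * phiSup g φ β.1) {β : TestForm n X k} {c : ℝ} (hc : 0 ≤ c)
    (hβ : ∀ (x : X) (v : Fin k → TangentSpace (𝓡 n) x), IsOrthonormalFrame g x v →
      |β.1 x v| ≤ c) : |T β| ≤ lam * c := by
  refine abs_le'.2 ⟨(hT β).trans ?_, ?_⟩
  · gcongr
    exact phiSup_le hc fun x v hv ↦ (abs_le.1 (hβ x v hv.1)).2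
  · rw [← map_neg]
    refine (hT (-β)).trans ?_
    gcongr
    exact phiSup_le hc fun x v hv ↦ neg_le.1 (abs_le.1 (hβ x v hv.1)).1

/-- A linear functional majorized by a multiple of `phiSup` is a current. -/
def Current.ofLePhiSup (T : TestForm n X k →ₗ[ℝ] ℝ) {lam : ℝ} (hlam : 0 ≤ lam)
    (hT : ∀ β, T β ≤ lam * phiSup g φ β.1) : Current n X k where
  toFun := T
  continuous' α hα := by
    rw [Metric.tendsto_nhds]
    intro ε hε
    -- The denominator `lam + 1` is positive even for `lam = 0` and makes the final inequality
    -- strict.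
    filter_upwards [hα.eventually_frame_le g (ε := ε / (lam + 1)) (by positivity)] with j hj
    rw [dist_zero_right, Real.norm_eq_abs]
    refine (abs_le_mul_of_le_mul_phiSup hlam hT (by positivity) hj).trans_lt ?_
    rw [mul_div_assoc', div_lt_iff₀ (by positivity)]
    nlinarith

theorem Current.apply_le_of_mass_le {T : Current n X k} {lam : ℝ} (hlam : 0 ≤ lam)
    (hT : T.mass g ≤ ENNReal.ofReal lam) {β : TestForm n X k} (hβ : ∀ x, comassAt g β.1 x ≤ 1) :
    T β ≤ lam :=
  (ENNReal.ofReal_le_ofReal_iff hlam).1 ((le_iSup₂ (f := fun (β : TestForm n X k)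
    (_ : ∀ x, comassAt g β.1 x ≤ 1) ↦ ENNReal.ofReal (T β)) β hβ).trans hT)

end Calibration

/-! ### The two implications -/

section Primitive

variable {n : ℕ} {X : Type*} [TopologicalSpace X] [ChartedSpace (EuclideanSpace ℝ (Fin n)) X]
  [IsManifold (𝓡 n) ∞ X] {k : ℕ} {g : RMetric n X} {φ : FormField n X (k + 1)}

theorem Current.neg_le_boundary_apply [T2Space X] [SecondCountableTopology X]
    (hφ : IsCalibration g φ) {T : Current n X (k + 1)} (hT : T.Positive g φ) {lam : ℝ}
    (hlam : 0 ≤ lam) (hmass : T.mass g ≤ ENNReal.ofReal lam) {α : TestForm n X k}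
    (hα : FormPositive g φ (extD α.1 + φ)) : -lam ≤ T.boundary α := by
  obtain ⟨β, f, hβ, hf, hf1⟩ := hφ.smooth.exists_testForm_cutoff (TestForm.d α).2.2
  have hpos : FormPositive g φ ((TestForm.d α) + β).1 := by
    intro x v hv
    have hval : ((TestForm.d α) + β).1 x v = extD α.1 x v + f x * φ x v := by
      change extD α.1 x v + β.1 x v = _
      rw [hβ x]
      rfl
    rw [hval]
    -- Where dα vanishes, the value on G(φ) is `f x ≥ 0`; elsewhere `f x = 1` and the hypothesis on
    -- `α` applies.
    by_cases hx : extD α.1 x = 0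
    · rw [hx, hv.2]
      simpa using (hf x).1
    · rw [hf1 x (subset_closure hx), one_mul]
      exact hα x v hv
  have hcomass : ∀ x, comassAt g β.1 x ≤ 1 := fun x ↦ comassAt_le_one_iff.2 fun v hv ↦ by
    rw [hβ x]
    change |f x * φ x v| ≤ 1
    rw [abs_mul, abs_of_nonneg (hf x).1]
    exact mul_le_one₀ (hf x).2 (abs_nonneg _) (hφ.abs_le_one hv)
  have h1 : 0 ≤ T.toFun (TestForm.d α) + T.toFun β := by
    rw [← map_add]
    exact hT _ hpos
  have h2 : T.toFun β ≤ lam := T.apply_le_of_mass_le hlam hmass hcomass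
  change -lam ≤ T.toFun (TestForm.d α)
  linarith

/-- Since φ = 1 on G(φ), the form d(-α/t) + φ is positive as soon as t > 0 bounds dα there. The
supremum itself may be 0, so t is taken strictly larger and then decreased to it. -/
theorem Current.apply_le_mul_phiSup {S : Current n X k} {lam : ℝ}
    (hS : ∀ α : TestForm n X k, FormPositive g φ (extD α.1 + φ) → -lam ≤ S α)
    (α : TestForm n X k) : S α ≤ lam * phiSup g φ (TestForm.d α).1 := by
  have key : ∀ t : ℝ, phiSup g φ (TestForm.d α).1 < t → S α ≤ lam * t := by
    intro t ht
    have ht0 : 0 < t := (phiSup_nonneg (TestForm.d α)).trans_lt ht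
    have h := hS (-t⁻¹ • α) fun x v hv ↦ by
      have h1 : (extD (-t⁻¹ • α).1 + φ) x v = -t⁻¹ * (TestForm.d α).1 x v + φ x v := by
        change extD (-t⁻¹ • α.1) x v + φ x v = _
        rw [extD_smul]
        rfl
      rw [h1, hv.2]
      have h2 : t⁻¹ * (TestForm.d α).1 x v ≤ 1 :=
        (inv_mul_le_one₀ ht0).2 ((le_phiSup (TestForm.d α) hv).trans ht.le)
      linarith
    have h3 : S.toFun (-t⁻¹ • α) = -(t⁻¹ * S.toFun α) := by
      rw [map_smul, smul_eq_mul, neg_mul]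
    have h4 : t⁻¹ * S.toFun α ≤ lam := by
      have h' : -lam ≤ S.toFun (-t⁻¹ • α) := h
      linarith
    rw [inv_mul_le_iff₀ ht0, mul_comm] at h4
    exact h4
  refine ge_of_tendsto (x := 𝓝[>] phiSup g φ (TestForm.d α).1) (f := fun t ↦ lam * t) ?_
    (eventually_mem_nhdsWithin.mono key)
  exact ((continuous_const_mul lam).tendsto _).mono_left nhdsWithin_le_nhds

theorem Current.exists_linearMap_comp_d_eq {S : Current n X k} {lam : ℝ} (hlam : 0 ≤ lam)
    (hS : ∀ α : TestForm n X k, S α ≤ lam * phiSup g φ (TestForm.d α).1) :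
    ∃ T : TestForm n X (k + 1) →ₗ[ℝ] ℝ, (∀ α : TestForm n X k, T (TestForm.d α) = S α) ∧
      ∀ β, T β ≤ lam * phiSup g φ β.1 :=
  exists_comp_eq_of_le_sublinear (E := TestForm n X k) (F := TestForm n X (k + 1))
    TestForm.d S.toFun (fun β ↦ lam * phiSup g φ β.1)
    (fun c hc β ↦ by rw [phiSup_smul hc]; ring)
    (fun β γ ↦ by rw [← mul_add]; exact mul_le_mul_of_nonneg_left (phiSup_add_le β γ) hlam) hS

theorem Current.positive_ofLePhiSup {T : TestForm n X k →ₗ[ℝ] ℝ} {ψ : FormField n X k} {lam : ℝ}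
    (hlam : 0 ≤ lam) (hT : ∀ β, T β ≤ lam * phiSup g ψ β.1) :
    (Current.ofLePhiSup T hlam hT).Positive g ψ := by
  intro β hβ
  have h := hT (-β)
  have h1 : phiSup g ψ (-β).1 ≤ 0 := phiSup_le le_rfl fun x v hv ↦ neg_nonpos.2 (hβ x v hv)
  rw [map_neg T β] at h
  have h2 := mul_nonpos_of_nonneg_of_nonpos hlam h1
  change 0 ≤ T β
  linarith

theorem Current.mass_ofLePhiSup_le {T : TestForm n X k →ₗ[ℝ] ℝ} {ψ : FormField n X k} {lam : ℝ}
    (hlam : 0 ≤ lam) (hT : ∀ β, T β ≤ lam * phiSup g ψ β.1) :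
    (Current.ofLePhiSup T hlam hT).mass g ≤ ENNReal.ofReal lam := by
  refine iSup₂_le fun β hβ ↦ ENNReal.ofReal_le_ofReal ?_
  have h := abs_le_mul_of_le_mul_phiSup hlam hT zero_le_one fun x ↦ comassAt_le_one_iff.1 (hβ x)
  exact (le_abs_self _).trans (h.trans_eq (mul_one lam))

end Primitive

end

theorem theorem4p4 (n k : ℕ) (X : Type*) [TopologicalSpace X] [T2Space X]
    [SecondCountableTopology X] [ChartedSpace (EuclideanSpace ℝ (Fin n)) X]
    [IsManifold (𝓡 n) ∞ X] (g : RMetric n X) (φ : FormField n X (k + 1))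
    (hφ : IsCalibration g φ) (S : Current n X k) (lam : ℝ) (hlam : 0 < lam) :
    (∃ T : Current n X (k + 1),
        T.Positive g φ ∧ T.boundary = S ∧ T.mass g ≤ ENNReal.ofReal lam) ↔
      ∀ α : TestForm n X k, FormPositive g φ (extD α.1 + φ) → -lam ≤ S α := by
  constructor
  · rintro ⟨T, hT, rfl, hmass⟩ α hα
    exact T.neg_le_boundary_apply hφ hT hlam.le hmass hα
  · intro hS
    obtain ⟨T, hTd, hT⟩ := Current.exists_linearMap_comp_d_eq (g := g) (φ := φ) hlam.le
      (Current.apply_le_mul_phiSup hS)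
    exact ⟨.ofLePhiSup T hlam.le hT, Current.positive_ofLePhiSup hlam.le hT,
      Current.ext (LinearMap.ext hTd), Current.mass_ofLePhiSup_le hlam.le hT⟩
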